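/- A complex equiangular $(6,3)$-frame is a collection of unit vectors $\varphi_1,\dots,\varphi_6\in\mathbb{C}^3$ attaining the Welch bound, i.e. $|\langle\varphi_i,\varphi_j\rangle|=\sqrt{\frac{6-3}{3\cdot 5}}=\frac{1}{\sqrt5}$ for all $i\neq j$. Its Gram matrix is $G=F^*F$, where $F$ is the $3\times 6$ matrix with columns $\varphi_1,\dots,\varphi_6$. Two matrices $G,G'\in\mathbb{C}^{6\times 6}$ are called equivalent if $G'=PDGD^*P^T$ for some permutation matrix $P$ and some unitary diagonal matrix $D$. For $a\in\mathbb{C}$ with $|a|=1$ put \[G_6^{(1)}(a)=\frac{1}{\sqrt5}\begin{bmatrix} \sqrt5 & 1 & 1 & 1 & 1 & 1\\ 1 & \sqrt5 & a & -a & -1 & 1\\ 1 & \overline{a} & \sqrt5 & 1 & -\overline{a} & -1\\ 1 & -\overline{a} & 1 & \sqrt5 & \overline{a} & -1\\ 1 & -1 & -a & a & \sqrt5 & 1\\ 1 & 1 & -1 & -1 & 1 & \sqrt5 \end{bmatrix}.\] Proposition. For every $a\in\mathbb{C}$ with $|a|=1$, the matrix $G_6^{(1)}(a)$ is the Gram matrix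 of a complex equiangular $(6,3)$-frame. Conversely, the Gram matrix of every complex equiangular $(6,3)$-frame is equivalent to $G_6^{(1)}(a)$ for some $a\in\mathbb{C}$ with $|a|=1$. -/

import Mathlib

open Matrix
open scoped ComplexConjugate

/-- The Welch bound `α_{n,m} = √((n - m) / (m (n - 1)))`, computed in the reals. -/
noncomputable def welchAngle (n m : ℕ) : ℝ :=
  √(((n : ℝ) - m) / (m * ((n : ℝ) - 1)))

/-- A complex equiangular `(n,m)`-frame, for `1 ≤ m ≤ n`: `n` unit vectors of `ℂ^m` all of whose
mutual inner products have the smallest possible modulus, that is, attain the Welch bound. Attaining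
this bound is what makes such a system a tight frame, so tightness is not listed as a condition. -/
structure IsEquiangularFrame {n m : ℕ} (φ : Fin n → EuclideanSpace ℂ (Fin m)) : Prop where
  norm_eq_one : ∀ i, ‖φ i‖ = 1
  norm_inner_eq : ∀ i j, i ≠ j → ‖inner ℂ (φ i) (φ j)‖ = welchAngle n m

/-- Two matrices are equivalent when `G' = P D G D* Pᵀ` for some permutation matrix `P` and some
unitary diagonal matrix `D`. -/
def GramEquivalent {n : ℕ} (G G' : Matrix (Fin n) (Fin n) ℂ) : Prop :=
  ∃ (σ : Equiv.Perm (Fin n)) (d : Fin n → ℂ), (∀ i, ‖d i‖ = 1) ∧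
    G' = σ.permMatrix ℂ * diagonal d * G * (diagonal d)ᴴ * (σ.permMatrix ℂ)ᵀ

/-- The matrix `G_6^{(1)}(a)`; the entry `s` stands for `√5`. -/
noncomputable def gramFamilySix (a : ℂ) : Matrix (Fin 6) (Fin 6) ℂ :=
  let s : ℂ := ((√5 : ℝ) : ℂ)
  (1 / s) •
    !![s,       1,       1,  1,       1,  1;
       1,       s,       a, -a,      -1,  1;
       1,  conj a,       s,  1, -conj a, -1;
       1, -conj a,       1,  s,  conj a, -1;
       1,      -1,      -a,  a,       s,  1;
       1,       1,      -1, -1,       1,  s]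

-- Write `G = 1 + S/√5`. Equality in the Welch bound forces tightness, `G² = 2G`, which says `S² =
-- 5`: `S` is a Hermitian conference matrix, and a unitary diagonal makes its first row `(0, 1, 1,
-- 1, 1, 1)`. Every other row then has four unimodular core entries with sum zero, hence two
-- opposite pairs. If no core row repeats an entry, orthogonality forbids two rows from sharing an
-- opposite pair. Up to relabelling this leaves one pattern of pairs, and it forces a repetition
-- after all (`exists_repeated`). A repetition makes a row real (`row_eq_of_repeated`), and one real
-- row leaves a single free parameter `a` (`eq_family`). For existence, `G/2` is an orthogonal
-- projection of rank 3, so `G` is a Gram matrix in dimension 3 (`exists_gram_eq`).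

/-- Among four unimodular numbers with sum zero, the first is opposite to another one. -/
theorem eq_neg_of_unimodular_sum_eq_zero {x y z w : ℂ} (hx : x * conj x = 1) (hy : y * conj y = 1)
    (hz : z * conj z = 1) (hw : w * conj w = 1) (h : x + y + z + w = 0) :
    x = -y ∨ x = -z ∨ x = -w := by
  have hc : conj x + conj y + conj z + conj w = 0 := by
    simpa using congrArg conj h
  -- The product is `x²·e₁ + e₃` in the elementary symmetric functions, and `e₃ = xyzw · conj e₁`
  -- for unimodular numbers.
  have key : (x + y) * ((x + z) * (x + w)) = 0 := by
    linear_combination x ^ 2 * h + x * y * z * w * hc - y * z * w * hx - x * z * w * hy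
      - x * y * w * hz - x * y * z * hw
  simpa [mul_eq_zero, add_eq_zero_iff_eq_neg] using key

-- Normalized conference matrices

/-- Hermitian conference matrices of order six whose first row is `(0, 1, 1, 1, 1, 1)`. -/
structure IsNormalizedConference (S : Matrix (Fin 6) (Fin 6) ℂ) : Prop where
  conj_apply : ∀ i j, conj (S i j) = S j i
  diag : ∀ i, S i i = 0
  mul_symm : ∀ i j, i ≠ j → S i j * S j i = 1
  ortho : ∀ i j, i ≠ j → ∑ k, S i k * S k j = 0
  first : ∀ i, i ≠ 0 → S 0 i = 1

namespace IsNormalizedConference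

variable {S : Matrix (Fin 6) (Fin 6) ℂ}

theorem first_col (hS : IsNormalizedConference S) {i : Fin 6} (hi : i ≠ 0) : S i 0 = 1 := by
  rw [← hS.conj_apply, hS.first i hi, map_one]

theorem ne_zero (hS : IsNormalizedConference S) {i j : Fin 6} (h : i ≠ j) : S i j ≠ 0 :=
  left_ne_zero_of_mul_eq_one (hS.mul_symm i j h)

theorem mul_conj (hS : IsNormalizedConference S) {i j : Fin 6} (h : i ≠ j) :
    S i j * conj (S i j) = 1 := by
  rw [hS.conj_apply, hS.mul_symm i j h]

theorem row_sum (hS : IsNormalizedConference S) {i : Fin 6} (hi : i ≠ 0) :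
    S i 1 + S i 2 + S i 3 + S i 4 + S i 5 = 0 := by
  have h := hS.ortho i 0 hi
  simpa [Fin.sum_univ_six, hS.diag, hS.first_col] using h

theorem ortho_core (hS : IsNormalizedConference S) {i j : Fin 6} (hi : i ≠ 0) (hj : j ≠ 0)
    (h : i ≠ j) :
    1 + S i 1 * S 1 j + S i 2 * S 2 j + S i 3 * S 3 j + S i 4 * S 4 j + S i 5 * S 5 j = 0 := by
  have h := hS.ortho i j h
  simpa [Fin.sum_univ_six, hS.first_col hi, hS.first j hj] using h

theorem reindex (hS : IsNormalizedConference S) (σ : Equiv.Perm (Fin 6)) (h0 : σ 0 = 0) :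
    IsNormalizedConference (S.submatrix σ σ) where
  conj_apply i j := hS.conj_apply _ _
  diag i := hS.diag _
  mul_symm i j h := hS.mul_symm _ _ (σ.injective.ne h)
  ortho i j h := by
    rw [← hS.ortho (σ i) (σ j) (σ.injective.ne h)]
    exact Equiv.sum_comp σ fun k => S (σ i) k * S k (σ j)
  first i hi := by
    simp only [submatrix_apply, h0]
    exact hS.first _ fun h => hi (σ.injective (h.trans h0.symm))

/-- If a core row has a repeated entry `z`, then `z = ± 1` and the row is `(z, -z, -z, z)`. -/
theorem row_eq_of_repeated (hS : IsNormalizedConference S) (h : S 5 1 = S 5 4) :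
    (S 5 1 = 1 ∨ S 5 1 = -1) ∧ S 5 2 = -S 5 1 ∧ S 5 3 = -S 5 1 := by
  have hr := hS.row_sum (i := 5) (by decide)
  rw [hS.diag 5] at hr
  have h52 : S 5 2 = -S 5 1 := by
    rcases eq_neg_of_unimodular_sum_eq_zero (hS.mul_conj (i := 5) (j := 2) (by decide))
      (hS.mul_conj (i := 5) (j := 1) (by decide)) (hS.mul_conj (i := 5) (j := 4) (by decide))
      (hS.mul_conj (i := 5) (j := 3) (by decide)) (by linear_combination hr) with h1 | h1 | h1
    · exact h1
    · rw [h1, h]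
    · exact absurd (by linear_combination hr / 2 + h / 2 - h1 / 2 : S 5 1 = 0)
        (hS.ne_zero (by decide))
  have h53 : S 5 3 = -S 5 1 := by linear_combination hr - h52 + h
  refine ⟨?_, h52, h53⟩
  have h15 := hS.mul_symm 5 1 (by decide)
  have h14 := hS.mul_symm 1 4 (by decide)
  have r1 := hS.row_sum (i := 1) (by decide)
  have o1 := hS.ortho_core (i := 1) (j := 5) (by decide) (by decide) (by decide)
  have c4 : S 4 5 = S 1 5 := by rw [← hS.conj_apply 5 4, ← h, hS.conj_apply]
  have c2 : S 2 5 = -S 1 5 := by rw [← hS.conj_apply 5 2, h52, map_neg, hS.conj_apply]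
  have c3 : S 3 5 = -S 1 5 := by rw [← hS.conj_apply 5 3, h53, map_neg, hS.conj_apply]
  rw [hS.diag 1] at r1 o1
  rw [hS.diag 5, c2, c3, c4] at o1
  -- With `z = S 5 1`, this says `S 1 4 = -Re z`; as `S 1 4` is unimodular, `z` must be real.
  have e : 2 * S 1 4 = -(S 5 1 + S 1 5) := by
    linear_combination r1 + S 5 1 * o1 + (S 1 2 + S 1 3 - S 1 4) * h15
  have e' : 2 * S 4 1 = -(S 5 1 + S 1 5) := by
    have := congrArg conj e
    simp only [map_mul, map_neg, map_add, hS.conj_apply, Complex.conj_ofNat] at this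
    linear_combination this
  have hz : (S 5 1 - S 1 5) ^ 2 = 0 := by
    linear_combination 4 * h14 - 4 * h15 - 2 * S 4 1 * e + (S 5 1 + S 1 5) * e'
  have hz' : S 1 5 = S 5 1 := (sub_eq_zero.1 (pow_eq_zero_iff two_ne_zero |>.1 hz)).symm
  rw [hz'] at h15
  exact mul_self_eq_one_iff.1 h15

/-- A normalized conference matrix with a real core row `(1, -1, -1, 1)` belongs to the family. -/
theorem eq_family (hS : IsNormalizedConference S) (h1 : S 5 1 = 1) (h2 : S 5 2 = -1)
    (h3 : S 5 3 = -1) (h4 : S 5 4 = 1) :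
    S = !![0, 1, 1, 1, 1, 1;
      1, 0, S 1 2, -S 1 2, -1, 1;
      1, conj (S 1 2), 0, 1, -conj (S 1 2), -1;
      1, -conj (S 1 2), 1, 0, conj (S 1 2), -1;
      1, -1, -S 1 2, S 1 2, 0, 1;
      1, 1, -1, -1, 1, 0] := by
  have h1' : S 1 5 = 1 := by rw [← hS.conj_apply, h1, map_one]
  have h2' : S 2 5 = -1 := by rw [← hS.conj_apply, h2, map_neg, map_one]
  have h3' : S 3 5 = -1 := by rw [← hS.conj_apply, h3, map_neg, map_one]
  have h4' : S 4 5 = 1 := by rw [← hS.conj_apply, h4, map_one]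
  have r1 := hS.row_sum (i := 1) (by decide)
  have r2 := hS.row_sum (i := 2) (by decide)
  have r4 := hS.row_sum (i := 4) (by decide)
  have o1 := hS.ortho_core (i := 1) (j := 5) (by decide) (by decide) (by decide)
  have o2 := hS.ortho_core (i := 2) (j := 5) (by decide) (by decide) (by decide)
  simp only [hS.diag, h1', h2', h3', h4'] at r1 r2 r4 o1 o2
  -- The row sum and the orthogonality to row 5 differ in the sign of `S 1 2 + S 1 3`, so adding
  -- them isolates `S 1 4`; `S 2 3` is similar.
  have e14 : S 1 4 = -1 := by linear_combination (r1 + o1) / 2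
  have e23 : S 2 3 = 1 := by linear_combination (r2 - o2) / 2
  have e41 : S 4 1 = -1 := by rw [← hS.conj_apply, e14, map_neg, map_one]
  have e32 : S 3 2 = 1 := by rw [← hS.conj_apply, e23, map_one]
  have e21 : S 2 1 = conj (S 1 2) := (hS.conj_apply _ _).symm
  have e13 : S 1 3 = -S 1 2 := by linear_combination r1 - e14
  have e31 : S 3 1 = -conj (S 1 2) := by rw [← hS.conj_apply, e13, map_neg]
  have e24 : S 2 4 = -conj (S 1 2) := by linear_combination r2 - e23 - e21
  have e42 : S 4 2 = -S 1 2 := by rw [← hS.conj_apply, e24, map_neg, Complex.conj_conj]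
  have e43 : S 4 3 = S 1 2 := by linear_combination r4 - e41 - e42
  have e34 : S 3 4 = conj (S 1 2) := by rw [← hS.conj_apply, e43]
  ext i j
  fin_cases i <;> fin_cases j <;>
    simp [hS.diag, hS.first, hS.first_col, e14, e23, e41, e32, e21, e13, e31, e24, e42, e43, e34,
      h1, h2, h3, h4, h1', h2', h3', h4']

-- Opposite pairs and the existence of a repeated entry

/-- Reindexing by an injective tuple that starts with the index `0`. -/
theorem reindex_of_injective (hS : IsNormalizedConference S) {f : Fin 6 → Fin 6}
    (hf : Function.Injective f) (h0 : f 0 = 0) : IsNormalizedConference (S.submatrix f f) :=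
  hS.reindex (Equiv.ofBijective f (Finite.injective_iff_bijective.1 hf)) h0

theorem row_one_split (hS : IsNormalizedConference S) :
    S 1 2 = -S 1 3 ∧ S 1 4 = -S 1 5 ∨ S 1 2 = -S 1 4 ∧ S 1 3 = -S 1 5 ∨
      S 1 2 = -S 1 5 ∧ S 1 3 = -S 1 4 := by
  have hr := hS.row_sum (i := 1) (by decide)
  rw [hS.diag] at hr
  rcases eq_neg_of_unimodular_sum_eq_zero (hS.mul_conj (i := 1) (j := 2) (by decide))
    (hS.mul_conj (i := 1) (j := 3) (by decide)) (hS.mul_conj (i := 1) (j := 4) (by decide))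
    (hS.mul_conj (i := 1) (j := 5) (by decide)) (by linear_combination hr) with h | h | h
  · exact Or.inl ⟨h, by linear_combination hr - h⟩
  · exact Or.inr (Or.inl ⟨h, by linear_combination hr - h⟩)
  · exact Or.inr (Or.inr ⟨h, by linear_combination hr - h⟩)

/-- The splitting of a core row into opposite pairs. -/
theorem row_split (hS : IsNormalizedConference S) (i a b c d : Fin 6)
    (hp : Function.Injective ![0, i, a, b, c, d]) :
    S i a = -S i b ∧ S i c = -S i d ∨ S i a = -S i c ∧ S i b = -S i d ∨
      S i a = -S i d ∧ S i b = -S i c :=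
  (hS.reindex_of_injective hp rfl).row_one_split

/-- In the orthogonality of rows 4 and 5, the terms for `k = 1, 2` are both `-1`, leaving `S 4 3 * S
3 5 = 1`. -/
theorem eq_of_opposite_one_two (hS : IsNormalizedConference S) (h1 : S 1 4 = -S 1 5)
    (h2 : S 2 4 = -S 2 5) : S 3 4 = S 3 5 := by
  have o := hS.ortho_core (i := 4) (j := 5) (by decide) (by decide) (by decide)
  rw [hS.diag, hS.diag] at o
  have m1 := hS.mul_symm 1 4 (by decide)
  have m2 := hS.mul_symm 2 4 (by decide)
  have m3 := hS.mul_symm 3 4 (by decide)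
  have e : S 4 3 * S 3 5 = 1 := by
    linear_combination o - S 4 1 * h1 - S 4 2 * h2 + m1 + m2
  linear_combination S 3 5 * m3 - S 3 4 * e

/-- If two core columns are opposite in two core rows, then they agree in the third one. -/
theorem eq_of_opposite (hS : IsNormalizedConference S) (a b c i j : Fin 6)
    (hp : Function.Injective ![0, a, b, c, i, j]) (ha : S a i = -S a j) (hb : S b i = -S b j) :
    S c i = S c j :=
  (hS.reindex_of_injective hp rfl).eq_of_opposite_one_two ha hb

/-- Along two closed trails of length five, all entries are `± i`. -/
theorem false_of_trails (hS : IsNormalizedConference S)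
    (hne : ∀ k i j : Fin 6, Function.Injective ![0, k, i, j] → S k i ≠ S k j)
    (p1 : S 1 2 = -S 1 3) (q1 : S 1 4 = -S 1 5)
    (p2 : S 2 1 = -S 2 4) (q2 : S 2 3 = -S 2 5) (p3 : S 3 1 = -S 3 5) (q3 : S 3 2 = -S 3 4)
    (p4 : S 4 1 = -S 4 3) (q4 : S 4 2 = -S 4 5) (p5 : S 5 1 = -S 5 2) (q5 : S 5 3 = -S 5 4) :
    False := by
  have c {i j k l : Fin 6} (h : S i j = -S k l) : S j i = -S l k := by
    rw [← hS.conj_apply i j, h, map_neg, hS.conj_apply]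
  -- Alternating row relations with conjugated ones gives `S 1 2 = -S 1 3 = S 5 3 = -S 5 4 = S 2 4 =
  -- -S 2 1`.
  have e : S 1 2 = -S 2 1 := by
    linear_combination p1 - c p3 + q5 - c q4 + p2
  have f : S 1 4 = -S 4 1 := by
    linear_combination q1 - c p5 + q2 - c q3 + p4
  have m2 := hS.mul_symm 1 2 (by decide)
  have m4 := hS.mul_symm 1 4 (by decide)
  -- Both squares are `-1`, so `S 1 2 = ± S 1 4`, and `-S 1 4` is `S 1 5`.
  have g : (S 1 2 - S 1 4) * (S 1 2 - S 1 5) = 0 := by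
    linear_combination S 1 2 * e - S 1 4 * f - m2 + m4 - (S 1 2 - S 1 4) * q1
  rcases mul_eq_zero.1 g with g | g
  · exact hne 1 2 4 (by decide) (sub_eq_zero.1 g)
  · exact hne 1 2 5 (by decide) (sub_eq_zero.1 g)

/-- Any split of rows 3, 4, 5 that shares a pair with another row creates a repetition; the
surviving splits are those of `false_of_trails`. -/
theorem false_of_two_splits (hS : IsNormalizedConference S)
    (hne : ∀ k i j : Fin 6, Function.Injective ![0, k, i, j] → S k i ≠ S k j)
    (p1 : S 1 2 = -S 1 3) (q1 : S 1 4 = -S 1 5)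
    (p2 : S 2 1 = -S 2 4) (q2 : S 2 3 = -S 2 5) : False := by
  rcases hS.row_split 3 1 2 4 5 (by decide) with ⟨_, q3⟩ | ⟨p3, _⟩ | ⟨p3, q3⟩
  · exact hne 2 4 5 (by decide) (hS.eq_of_opposite 1 3 2 4 5 (by decide) q1 q3)
  · exact hne 5 1 4 (by decide) (hS.eq_of_opposite 2 3 5 1 4 (by decide) p2 p3)
  rcases hS.row_split 4 1 2 3 5 (by decide) with ⟨_, q4⟩ | ⟨p4, q4⟩ | ⟨_, q4⟩
  · exact hne 1 3 5 (by decide) (hS.eq_of_opposite 2 4 1 3 5 (by decide) q2 q4)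
  · rcases hS.row_split 5 1 2 3 4 (by decide) with ⟨p5, q5⟩ | ⟨p5, _⟩ | ⟨p5, _⟩
    · exact hS.false_of_trails hne p1 q1 p2 q2 p3 q3 p4 q4 p5 q5
    · exact hne 2 1 3 (by decide) (hS.eq_of_opposite 4 5 2 1 3 (by decide) p4 p5)
    · exact hne 3 1 4 (by decide) (hS.eq_of_opposite 2 5 3 1 4 (by decide) p2 p5)
  · exact hne 5 2 3 (by decide) (hS.eq_of_opposite 1 4 5 2 3 (by decide) p1 q4)

/-- Row 2 cannot reuse the pair `{4, 5}`; its two other splits are exchanged by swapping 4 and 5. -/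
theorem false_of_split (hS : IsNormalizedConference S)
    (hne : ∀ k i j : Fin 6, Function.Injective ![0, k, i, j] → S k i ≠ S k j)
    (p1 : S 1 2 = -S 1 3) (q1 : S 1 4 = -S 1 5) : False := by
  rcases hS.row_split 2 1 3 4 5 (by decide) with ⟨_, q2⟩ | ⟨p2, q2⟩ | ⟨p2, q2⟩
  · exact hne 3 4 5 (by decide) (hS.eq_of_opposite 1 2 3 4 5 (by decide) q1 q2)
  · exact hS.false_of_two_splits hne p1 q1 p2 q2
  · refine (hS.reindex_of_injective (f := ![0, 1, 2, 3, 5, 4]) (by decide) rfl).false_of_two_splits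
      (fun k i j h => hne _ _ _ ?_) p1 (show S 1 5 = -S 1 4 by rw [q1, neg_neg]) p2 q2
    revert k i j; decide

theorem exists_repeated (hS : IsNormalizedConference S) :
    ∃ k i j : Fin 6, Function.Injective ![0, k, i, j] ∧ S k i = S k j := by
  by_contra! hne
  rcases hS.row_one_split with ⟨p, q⟩ | ⟨p, q⟩ | ⟨p, q⟩
  · exact hS.false_of_split hne p q
  · refine (hS.reindex_of_injective (f := ![0, 1, 2, 4, 3, 5]) (by decide) rfl).false_of_split
      (fun k i j h => hne _ _ _ ?_) p q
    revert k i j; decide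
  · refine (hS.reindex_of_injective (f := ![0, 1, 2, 5, 3, 4]) (by decide) rfl).false_of_split
      (fun k i j h => hne _ _ _ ?_) p q
    revert k i j; decide

/-- Up to a permutation, a normalized conference matrix belongs to the family. -/
theorem exists_perm_eq_family (hS : IsNormalizedConference S) :
    ∃ (σ : Equiv.Perm (Fin 6)) (a : ℂ), ‖a‖ = 1 ∧ S.submatrix σ σ =
      !![0, 1, 1, 1, 1, 1;
        1, 0, a, -a, -1, 1;
        1, conj a, 0, 1, -conj a, -1;
        1, -conj a, 1, 0, conj a, -1;
        1, -1, -a, a, 0, 1;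
        1, 1, -1, -1, 1, 0] := by
  suffices H : ∃ f : Fin 6 → Fin 6, Function.Injective f ∧ f 0 = 0 ∧ S (f 5) (f 1) = 1 ∧
      S (f 5) (f 2) = -1 ∧ S (f 5) (f 3) = -1 ∧ S (f 5) (f 4) = 1 by
    obtain ⟨f, hf, h0, h1, h2, h3, h4⟩ := H
    have hS' := hS.reindex_of_injective hf h0
    refine ⟨Equiv.ofBijective f (Finite.injective_iff_bijective.1 hf), S (f 1) (f 2), ?_,
      hS'.eq_family h1 h2 h3 h4⟩
    have h := hS'.mul_conj (i := 1) (j := 2) (by decide)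
    rw [Complex.mul_conj'] at h
    exact (pow_eq_one_iff_of_nonneg (norm_nonneg _) two_ne_zero).1 (by exact_mod_cast h)
  obtain ⟨k, i, j, hp, hk⟩ := hS.exists_repeated
  -- `l, m` are the two remaining indices. The second ordering puts `i, j` in the middle, for the
  -- case where the repeated entry is `-1`.
  have hlm : ∃ l m : Fin 6, Function.Injective ![0, i, l, m, j, k] ∧
      Function.Injective ![0, l, i, j, m, k] := by
    clear hk; revert k i j; decide
  obtain ⟨l, m, hf, hf'⟩ := hlm
  obtain ⟨h1, h2, h3⟩ := (hS.reindex_of_injective hf rfl).row_eq_of_repeated hk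
  change S k i = 1 ∨ S k i = -1 at h1
  change S k l = -S k i at h2
  change S k m = -S k i at h3
  rcases h1 with h1 | h1
  · refine ⟨_, hf, rfl, h1, ?_, ?_, hk ▸ h1⟩
    · exact h2.trans (by rw [h1])
    · exact h3.trans (by rw [h1])
  · refine ⟨_, hf', rfl, ?_, h1, hk ▸ h1, ?_⟩
    · exact h2.trans (by rw [h1, neg_neg])
    · exact h3.trans (by rw [h1, neg_neg])

end IsNormalizedConference

-- From the matrix family to frames

/-- A Hermitian matrix with `G ^ 2 = c G` and trace `c m` is a Gram matrix of vectors in `ℂ^m`. -/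
theorem exists_gram_eq {n m : ℕ} {G : Matrix (Fin n) (Fin n) ℂ} {c : ℝ} (hc : 0 < c)
    (hG : G.IsHermitian) (hsq : G * G = (c : ℂ) • G) (htr : G.trace = c * m) :
    ∃ φ : Fin n → EuclideanSpace ℂ (Fin m), Matrix.gram ℂ φ = G := by
  have hc' : (c : ℂ) ≠ 0 := by exact_mod_cast hc.ne'
  -- `B = G/c` is an orthogonal projection of rank `tr B = m`. The vectors `√c · B eᵢ`, in
  -- orthonormal coordinates of its range, have Gram matrix `c · B*B = G`.
  set B : Matrix (Fin n) (Fin n) ℂ := (c : ℂ)⁻¹ • G with hB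
  have hBB : B * B = B := by
    rw [hB, smul_mul_smul, hsq, smul_smul, mul_assoc, inv_mul_cancel₀ hc', mul_one]
  set A := Matrix.toEuclideanLin B with hA
  have hAA (x) : A (A x) = A x := by
    apply WithLp.ofLp_injective
    simp [hA, Matrix.mulVec_mulVec, hBB]
  have hproj : LinearMap.IsProj (LinearMap.range A) A :=
    ⟨fun x => ⟨x, rfl⟩, by rintro _ ⟨x, rfl⟩; exact hAA x⟩
  have hfr : Module.finrank ℂ (LinearMap.range A) = m := by
    have h := hproj.trace
    rw [hA, Matrix.toEuclideanLin, Matrix.toLpLin_eq_toLin, Matrix.trace_toLin_eq, hB,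
      Matrix.trace_smul, htr, smul_eq_mul, inv_mul_cancel_left₀ hc'] at h
    exact_mod_cast h.symm
  let b := (stdOrthonormalBasis ℂ (LinearMap.range A)).reindex (finCongr hfr)
  refine ⟨fun i => ((√c : ℝ) : ℂ) •
    b.repr ⟨A (EuclideanSpace.single i 1), LinearMap.mem_range_self A _⟩, ?_⟩
  have hs : ((√c : ℝ) : ℂ) * ((√c : ℝ) : ℂ) = c := by
    exact_mod_cast Real.mul_self_sqrt hc.le
  ext i j
  have h := congrFun (congrFun hsq i) j
  have hh (k : Fin n) : conj (G k i) = G i k := hG.apply i k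
  simp only [Matrix.gram_apply, inner_smul_left, inner_smul_right, LinearIsometryEquiv.inner_map_map,
    Submodule.coe_inner, PiLp.inner_apply, Complex.conj_ofReal]
  simp [hA, hB, hh, Matrix.mul_apply] at h ⊢
  calc _ = ((√c : ℝ) : ℂ) * ((√c : ℝ) : ℂ) * ((c : ℂ)⁻¹ * (c : ℂ)⁻¹ * ∑ k, G i k * G k j) := by
        rw [mul_assoc, Finset.mul_sum _ _ ((c : ℂ)⁻¹ * (c : ℂ)⁻¹)]
        refine congrArg _ (congrArg _ (Finset.sum_congr rfl fun k _ => ?_))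
        ring
    _ = G i j := by
        rw [hs, h]
        field_simp

theorem gramFamilySix_eq (a : ℂ) : gramFamilySix a = 1 + (1 / ((√5 : ℝ) : ℂ)) •
      !![0, 1, 1, 1, 1, 1;
        1, 0, a, -a, -1, 1;
        1, conj a, 0, 1, -conj a, -1;
        1, -conj a, 1, 0, conj a, -1;
        1, -1, -a, a, 0, 1;
        1, 1, -1, -1, 1, 0] := by
  have h : ((√5 : ℝ) : ℂ) ≠ 0 := by simp
  ext i j
  fin_cases i <;> fin_cases j <;> simp [gramFamilySix, h]

theorem gramFamilySix_isHermitian (a : ℂ) : (gramFamilySix a).IsHermitian := by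
  ext i j
  fin_cases i <;> fin_cases j <;> simp [gramFamilySix]

theorem trace_gramFamilySix (a : ℂ) : (gramFamilySix a).trace = 6 := by
  simp [gramFamilySix_eq, Matrix.trace, Fin.sum_univ_six]
  norm_num

theorem gramFamilySix_mul_self {a : ℂ} (ha : ‖a‖ = 1) :
    gramFamilySix a * gramFamilySix a = (2 : ℂ) • gramFamilySix a := by
  have h : ((√5 : ℝ) : ℂ) ≠ 0 := by simp
  have h5 : ((√5 : ℝ) : ℂ) * ((√5 : ℝ) : ℂ) = 5 := by
    exact_mod_cast Real.mul_self_sqrt (by norm_num : (0 : ℝ) ≤ 5)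
  have hc : (1 / ((√5 : ℝ) : ℂ)) * (1 / ((√5 : ℝ) : ℂ)) * 5 = 1 := by
    rw [← h5]; field_simp
  have haa : a * conj a = 1 := by rw [Complex.mul_conj', ha]; simp
  rw [gramFamilySix_eq]
  generalize 1 / ((√5 : ℝ) : ℂ) = t at hc
  generalize hM : !![0, 1, 1, 1, 1, 1;
        1, 0, a, -a, -1, 1;
        1, conj a, 0, 1, -conj a, -1;
        1, -conj a, 1, 0, conj a, -1;
        1, -1, -a, a, 0, 1;
        1, 1, -1, -1, 1, (0 : ℂ)] = M
  -- With `5t² = 1` this gives `(1 + tM)² = 2(1 + tM)`.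
  have hMM : M * M = (5 : ℂ) • 1 := by
    rw [← hM]
    generalize conj a = b at haa
    have hbb : b * a = 1 := by rw [mul_comm, haa]
    ext i j
    fin_cases i <;> fin_cases j <;>
      simp [Matrix.mul_apply, Fin.sum_univ_six, haa, hbb] <;> norm_num
  rw [add_mul, mul_add, mul_add, smul_mul_smul, hMM, smul_smul, hc]
  simp only [one_mul, mul_one, one_smul]
  module

theorem norm_gramFamilySix {a : ℂ} (ha : ‖a‖ = 1) {i j : Fin 6} (h : i ≠ j) :
    ‖gramFamilySix a i j‖ = (√5)⁻¹ := by
  revert h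
  fin_cases i <;> fin_cases j <;> simp [gramFamilySix, ha, abs_of_nonneg]

theorem welchAngle_six_three : welchAngle 6 3 = (√5)⁻¹ := by
  rw [welchAngle, ← Real.sqrt_inv]; norm_num

theorem exists_frame_gram_eq {a : ℂ} (ha : ‖a‖ = 1) : ∃ φ : Fin 6 → EuclideanSpace ℂ (Fin 3),
    IsEquiangularFrame φ ∧ Matrix.gram ℂ φ = gramFamilySix a := by
  obtain ⟨φ, hφ⟩ := exists_gram_eq (m := 3) (c := 2) two_pos (gramFamilySix_isHermitian a)
    (by simpa using gramFamilySix_mul_self ha) (by rw [trace_gramFamilySix]; norm_num)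
  have hij (i j) : inner ℂ (φ i) (φ j) = gramFamilySix a i j := congrFun (congrFun hφ i) j
  refine ⟨φ, ⟨fun i => ?_, fun i j h => ?_⟩, hφ⟩
  · rw [← pow_eq_one_iff_of_nonneg (norm_nonneg _) two_ne_zero]
    have h := inner_self_eq_norm_sq_to_K (𝕜 := ℂ) (φ i)
    have h1 : gramFamilySix a i i = 1 := by
      rw [gramFamilySix_eq]; fin_cases i <;> simp
    rw [hij, h1] at h
    exact Complex.ofReal_injective (by simpa using h.symm)
  · rw [hij, norm_gramFamilySix ha h, welchAngle_six_three]

-- From frames to conference matrices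

/-- Equiangular `(6,3)`-frames are tight. -/
theorem IsEquiangularFrame.gram_mul_gram {φ : Fin 6 → EuclideanSpace ℂ (Fin 3)}
    (hφ : IsEquiangularFrame φ) :
    Matrix.gram ℂ φ * Matrix.gram ℂ φ = (2 : ℂ) • Matrix.gram ℂ φ := by
  set F : Matrix (Fin 3) (Fin 6) ℂ := Matrix.of fun k i => φ i k
  have hF : Matrix.gram ℂ φ = Fᴴ * F :=
    Matrix.gram_eq_conjTranspose_mul (EuclideanSpace.basisFun (Fin 3) ℂ) φ
  have htr : (Matrix.gram ℂ φ).trace = 6 := by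
    simp [Matrix.trace, inner_self_eq_norm_sq_to_K, hφ.norm_eq_one]
  have hij (i j) : inner ℂ (φ i) (φ j) * inner ℂ (φ j) (φ i) = if i = j then 1 else (1 / 5 : ℂ) := by
    rw [← inner_conj_symm (φ j) (φ i), Complex.mul_conj']
    split_ifs with h
    · subst h
      rw [inner_self_eq_norm_sq_to_K, hφ.norm_eq_one]; simp
    · rw [hφ.norm_inner_eq i j h, welchAngle_six_three, ← Complex.ofReal_pow, inv_pow,
        Real.sq_sqrt (by norm_num)]
      simp
  have htr2 : (Matrix.gram ℂ φ * Matrix.gram ℂ φ).trace = 12 := by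
    simp only [Matrix.trace, Matrix.diag_apply, Matrix.mul_apply, Matrix.gram_apply, hij]
    simp [Fin.sum_univ_six]
    norm_num
  open scoped ComplexOrder in
  -- The squared Frobenius norm of the difference is `12 - 4·6 + 4·3 = 0`.
  have hT : F * Fᴴ - (2 : ℂ) • 1 = 0 := by
    rw [← Matrix.trace_conjTranspose_mul_self_eq_zero_iff]
    have e1 : (F * Fᴴ).trace = 6 := by rw [Matrix.trace_mul_comm, ← hF, htr]
    have e2 : (F * Fᴴ * (F * Fᴴ)).trace = 12 := by
      rw [← htr2, hF, Matrix.mul_assoc, Matrix.trace_mul_comm]; simp only [Matrix.mul_assoc]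
    simp only [Matrix.conjTranspose_sub, Matrix.conjTranspose_mul, Matrix.conjTranspose_conjTranspose,
      Matrix.conjTranspose_smul, Matrix.conjTranspose_one, sub_mul, mul_sub, Matrix.trace_sub, e2,
      smul_mul_assoc, mul_smul_comm, one_mul, mul_one, Matrix.trace_smul, e1, Matrix.trace_one]
    simp
    norm_num
  rw [hF, Matrix.mul_assoc, ← Matrix.mul_assoc F, sub_eq_zero.1 hT]
  simp

/-- The normalized conference matrix of an equiangular `(6,3)`-frame. -/
theorem IsEquiangularFrame.exists_normalized {φ : Fin 6 → EuclideanSpace ℂ (Fin 3)}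
    (hφ : IsEquiangularFrame φ) : ∃ d : Fin 6 → ℂ, (∀ i, ‖d i‖ = 1) ∧
      ∃ S, IsNormalizedConference S ∧
        ∀ i j, d i * Matrix.gram ℂ φ i j * conj (d j) =
          (1 + (1 / ((√5 : ℝ) : ℂ)) • S : Matrix (Fin 6) (Fin 6) ℂ) i j := by
  have hs : ((√5 : ℝ) : ℂ) ≠ 0 := by simp
  have hsc : conj ((√5 : ℝ) : ℂ) = ((√5 : ℝ) : ℂ) := Complex.conj_ofReal _
  have hsn : ‖((√5 : ℝ) : ℂ)‖ = √5 := by simp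
  set s : ℂ := ((√5 : ℝ) : ℂ)
  set G := Matrix.gram ℂ φ with hG
  have hGG := hφ.gram_mul_gram
  have hGc (i j) : conj (G i j) = G j i := inner_conj_symm (φ j) (φ i)
  have hG1 (i) : G i i = 1 := by
    rw [hG, Matrix.gram_apply, inner_self_eq_norm_sq_to_K, hφ.norm_eq_one]; simp
  have hGn (i j) (h : i ≠ j) : ‖s * G i j‖ = 1 := by
    rw [norm_mul, hsn, hG, Matrix.gram_apply, hφ.norm_inner_eq i j h, welchAngle_six_three,
      mul_inv_cancel₀ (by simp)]
  -- With this choice `S 0 i` becomes `|√5 · G 0 i|² = 1`.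
  let d : Fin 6 → ℂ := fun i => if i = 0 then 1 else s * G 0 i
  have hd (i) : ‖d i‖ = 1 := by
    by_cases h : i = 0
    · simp [d, h]
    · simp only [d, h, if_false]
      exact hGn 0 i (Ne.symm h)
  have hdd (i) : conj (d i) * d i = 1 := by
    rw [mul_comm, Complex.mul_conj', hd]; simp
  let S : Matrix (Fin 6) (Fin 6) ℂ :=
    Matrix.of fun i j => s * (d i * (G i j - (1 : Matrix _ _ ℂ) i j) * conj (d j))
  have hSc (i j) : conj (S i j) = S j i := by
    simp only [S, Matrix.of_apply, map_mul, map_sub, hsc, hGc, Complex.conj_conj, Matrix.one_apply,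
      apply_ite conj, map_one, map_zero, eq_comm]
    ring
  refine ⟨d, hd, S, ⟨hSc, fun i => by simp [S, hG1], fun i j h => ?_, fun i j h => ?_,
    fun i hi => ?_⟩, fun i j => ?_⟩
  · rw [← hSc i j, Complex.mul_conj']
    have : S i j = d i * (s * G i j) * conj (d j) := by
      simp only [S, Matrix.of_apply, Matrix.one_apply_ne h]; ring
    rw [this, norm_mul, norm_mul, hd, hGn i j h, RCLike.norm_conj, hd]; simp
  · have e : (G - 1) * (G - 1) = 1 := by
      rw [sub_mul, mul_sub, hGG]
      simp only [one_mul, mul_one]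
      module
    have e := congrFun (congrFun e i) j
    rw [Matrix.mul_apply, Matrix.one_apply_ne h] at e
    calc ∑ k, S i k * S k j
        = ∑ k, s * s * d i * conj (d j) * ((G - 1) i k * (G - 1) k j) := by
          refine Finset.sum_congr rfl fun k _ => ?_
          simp only [S, Matrix.of_apply, Matrix.sub_apply]
          linear_combination (s * s * d i * conj (d j) * ((G i k - (1 : Matrix _ _ ℂ) i k) *
            (G k j - (1 : Matrix _ _ ℂ) k j))) * hdd k
      _ = 0 := by rw [← Finset.mul_sum, e, mul_zero]
  · have : S 0 i = s * G 0 i * conj (s * G 0 i) := by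
      simp [S, d, hi, Matrix.one_apply_ne (Ne.symm hi), mul_assoc]
    rw [this, Complex.mul_conj', hGn 0 i (Ne.symm hi)]; simp
  · have : (1 / s) * s = 1 := by field_simp
    rw [Matrix.add_apply, Matrix.smul_apply, smul_eq_mul, Matrix.one_apply]
    split_ifs with h
    · subst h
      simp only [S, Matrix.of_apply, hG1, Matrix.one_apply_eq]
      linear_combination hdd i
    · simp only [S, Matrix.of_apply, Matrix.one_apply_ne h]
      linear_combination -(d i * G i j * conj (d j)) * this

theorem mainTheorem4 :
    (∀ a : ℂ, ‖a‖ = 1 →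
      ∃ φ : Fin 6 → EuclideanSpace ℂ (Fin 3),
        IsEquiangularFrame φ ∧ Matrix.gram ℂ φ = gramFamilySix a) ∧
    (∀ φ : Fin 6 → EuclideanSpace ℂ (Fin 3), IsEquiangularFrame φ →
      ∃ a : ℂ, ‖a‖ = 1 ∧ GramEquivalent (Matrix.gram ℂ φ) (gramFamilySix a)) := by
  refine ⟨fun a ha => exists_frame_gram_eq ha, fun φ hφ => ?_⟩
  obtain ⟨d, hd, S, hS, h⟩ := hφ.exists_normalized
  obtain ⟨σ, a, ha, hσ⟩ := hS.exists_perm_eq_family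
  refine ⟨a, ha, σ, d, hd, ?_⟩
  rw [gramFamilySix_eq, ← hσ, Matrix.mul_assoc, Matrix.mul_assoc, Matrix.mul_assoc,
    Matrix.transpose_permMatrix, PEquiv.toMatrix_toPEquiv_mul]
  simp only [← Matrix.mul_assoc]
  ext i j
  have h := h (σ i) (σ j)
  simp [PEquiv.mul_toMatrix_toPEquiv, Matrix.one_apply] at h ⊢
  exact h.symm
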